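/- For a real matrix $X\in\mathbb{R}^{m\times n}$ let $\sigma_1(X)\ge\dots\ge\sigma_{\min(m,n)}(X)\ge 0$ be its singular values, $\|X\|_{\mathrm{tr}}=\sum_{i=1}^{\min(m,n)}\sigma_i(X)$ its trace norm, and $\|X\|_{S_{1/3}}=\bigl(\sum_{i=1}^{\min(m,n)}\sigma_i(X)^{1/3}\bigr)^{3}$ its Schatten-$1/3$ quasi-norm. Fix $m,n,d$. For $X\in\mathbb{R}^{m\times n}$ with $\operatorname{rank}(X)\le d$, the tri-trace norm of $X$ is $$\|X\|_{\mathrm{Tri\text{-}tr}}=\min\bigl\{\|U\|_{\mathrm{tr}}\|V\|_{\mathrm{tr}}\|W\|_{\mathrm{tr}} : U\in\mathbb{R}^{m\times d},\ V\in\mathbb{R}^{d\times d},\ W\in\mathbb{R}^{n\times d},\ X=UVW^{T}\bigr\}.$$ **Theorem.** The minimum is attained for every $X\in\mathbb{R}^{m\times n}$ with $\operatorname{rank}(X)\le d$. The tri-trace norm is a quasi-norm on the matrices of rank at most $d$: for all $X$ with $\operatorname{rank}(X)\le d$ and all $a\in\mathbb{R}$ one has $\|X\|_{\mathrm{Tri\text{-}tr}}\ge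 0$, with equality if and only if $X=0$, and $\|aX\|_{\mathrm{Tri\text{-}tr}}=|a|\,\|X\|_{\mathrm{Tri\text{-}tr}}$; and there is a constant $\alpha\ge 1$ such that $\|X+Y\|_{\mathrm{Tri\text{-}tr}}\le\alpha\bigl(\|X\|_{\mathrm{Tri\text{-}tr}}+\|Y\|_{\mathrm{Tri\text{-}tr}}\bigr)$ whenever $X$, $Y$ and $X+Y$ have rank at most $d$. In particular, if $d\ge\min(m,n)$, it is a quasi-norm on the whole space $\mathbb{R}^{m\times n}$. Moreover, for every $X\in\mathbb{R}^{m\times n}$ with $\operatorname{rank}(X)\le d$, $$\|X\|_{\mathrm{Tri\text{-}tr}}=\|X\|_{S_{1/3}}.$$ -/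

import Mathlib

noncomputable section

/-- The `i`-th singular value (counted from `0`, in decreasing order) of a real `m × n` matrix,
regarded as a linear map from `ℝⁿ` to `ℝᵐ` with their Euclidean inner products. -/
def matSingularValue {m n : ℕ} (X : Matrix (Fin m) (Fin n) ℝ) (i : ℕ) : ℝ :=
  (Matrix.toEuclideanLin X).singularValues i

/-- The trace norm: the sum of the `min m n` singular values. -/
def traceNorm {m n : ℕ} (X : Matrix (Fin m) (Fin n) ℝ) : ℝ :=
  ∑ i ∈ Finset.range (min m n), matSingularValue X i

/-- The Schatten-`p` (quasi-)norm, `0 < p < ∞`. -/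
def schattenNorm {m n : ℕ} (p : ℝ) (X : Matrix (Fin m) (Fin n) ℝ) : ℝ :=
  (∑ i ∈ Finset.range (min m n), matSingularValue X i ^ p) ^ (1 / p)

/-- The values `‖U‖_tr ‖V‖_tr ‖W‖_tr` over all factorizations `X = U V Wᵀ` with `U` of size `m × d`,
`V` of size `d × d` and `W` of size `n × d`. -/
def triTraceValues {m n : ℕ} (d : ℕ) (X : Matrix (Fin m) (Fin n) ℝ) : Set ℝ :=
  {t | ∃ (U : Matrix (Fin m) (Fin d) ℝ) (V : Matrix (Fin d) (Fin d) ℝ)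
      (W : Matrix (Fin n) (Fin d) ℝ),
      X = U * V * W.transpose ∧ t = traceNorm U * traceNorm V * traceNorm W}

/-- The tri-trace norm with inner dimension `d`. It is meant for matrices of rank at most `d`;
the infimum is asserted to be a minimum in the theorem. -/
def triTraceNorm {m n : ℕ} (d : ℕ) (X : Matrix (Fin m) (Fin n) ℝ) : ℝ :=
  sInf (triTraceValues d X)

/-- `f` satisfies the axioms of a quasi-norm on the subset `S` of a real vector space. The subset
`S` is meant to be closed under scalar multiplication; it need not be closed under addition, so
the quasi-triangle inequality is required whenever `x`, `y` and `x + y` all lie in `S`. -/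
structure IsQuasiNormOn {E : Type*} [AddCommGroup E] [Module ℝ E] (S : Set E) (f : E → ℝ) :
    Prop where
  nonneg : ∀ x ∈ S, 0 ≤ f x
  eq_zero_iff : ∀ x ∈ S, (f x = 0 ↔ x = 0)
  smul : ∀ (a : ℝ), ∀ x ∈ S, f (a • x) = |a| * f x
  add_le : ∃ α : ℝ, 1 ≤ α ∧
    ∀ x ∈ S, ∀ y ∈ S, x + y ∈ S → f (x + y) ≤ α * (f x + f y)

/-- `f` is a quasi-norm on the real vector space `E`. -/
def IsQuasiNorm {E : Type*} [AddCommGroup E] [Module ℝ E] (f : E → ℝ) : Prop :=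
  IsQuasiNormOn Set.univ f

end

/-! Everything reduces to the identity with the Schatten-1/3 quasi-norm. For the lower bound, let `X
= U V Wᵀ` have singular vectors `p i`, `q i`. Gram–Schmidt applied to `Wᵀ q i` and to `V Wᵀ q i`
gives orthonormal `f`, `g` for which all factors are triangular, so `σ i` is the product of `⟪p i, U
g i⟫`, `⟪g i, V f i⟫` and `⟪q i, W f i⟫` (`exists_orthonormal_eq_mul_mul`). Hölder with three equal
exponents separates the factors, and each sum of absolute diagonal coefficients is at most the trace
norm (`sum_abs_inner_le_traceNorm`).

The bound is attained by giving `σ i ^ (1/3)` to each factor. The quasi-triangle inequality follows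
because the Schatten-1/3 quasi-norm and the trace norm, which is subadditive by duality, bound each
other up to a constant. -/

open InnerProductSpace Module

/-! ### Diagonal maps and trace duality -/

section LinearMaps

variable {E F G : Type*}
  [NormedAddCommGroup E] [InnerProductSpace ℝ E]
  [NormedAddCommGroup F] [InnerProductSpace ℝ F]
  [NormedAddCommGroup G] [InnerProductSpace ℝ G]

/-- The linear map `x ↦ ∑ i, s i ⟪q i, x⟫ p i`. -/
noncomputable def diagMap {ι : Type*} [Fintype ι] (s : ι → ℝ) (p : ι → F) (q : ι → E) : E →ₗ[ℝ] F :=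
  ∑ i, s i • (rankOne ℝ (p i) (q i)).toLinearMap

theorem diagMap_apply {ι : Type*} [Fintype ι] (s : ι → ℝ) (p : ι → F) (q : ι → E) (x : E) :
    diagMap s p q x = ∑ i, s i • inner ℝ (q i) x • p i := by
  simp [diagMap, LinearMap.sum_apply]

theorem diagMap_apply_self {ι : Type*} [Fintype ι] (s : ι → ℝ) (p : ι → F) {q : ι → E}
    (hq : Orthonormal ℝ q) (j : ι) : diagMap s p q (q j) = s j • p j := by
  classical
  rw [diagMap_apply]
  simp_rw [orthonormal_iff_ite.mp hq]
  simp

theorem diagMap_comp {ι : Type*} [Fintype ι] (s t : ι → ℝ) (p : ι → G) {e : ι → F} (q : ι → E)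
    (he : Orthonormal ℝ e) :
    diagMap s p e ∘ₗ diagMap t e q = diagMap (fun i => s i * t i) p q := by
  ext x
  rw [LinearMap.comp_apply, diagMap_apply t, map_sum, diagMap_apply]
  refine Finset.sum_congr rfl fun i _ => ?_
  rw [map_smul, map_smul, diagMap_apply_self s p he, smul_smul, smul_smul, smul_smul]
  congr 1
  ring

theorem adjoint_diagMap [FiniteDimensional ℝ E] [FiniteDimensional ℝ F]
    {ι : Type*} [Fintype ι] (s : ι → ℝ) (p : ι → F) (q : ι → E) :
    LinearMap.adjoint (diagMap s p q) = diagMap s q p := by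
  symm
  rw [LinearMap.eq_adjoint_iff]
  intro x y
  rw [diagMap_apply, diagMap_apply, sum_inner, inner_sum]
  refine Finset.sum_congr rfl fun i _ => ?_
  simp only [real_inner_smul_left, real_inner_smul_right]
  rw [real_inner_comm x (p i)]
  ring

/-- AM-GM in each term, then Bessel's inequality for both families. -/
theorem sum_abs_inner_mul_inner_le_one {κ : Type*} [Fintype κ] {e : κ → F} {f : κ → E}
    (he : Orthonormal ℝ e) (hf : Orthonormal ℝ f) {x : F} {y : E} (hx : ‖x‖ = 1) (hy : ‖y‖ = 1) :
    ∑ k, |inner ℝ (e k) x| * |inner ℝ (f k) y| ≤ 1 := by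
  have h1 := he.sum_inner_products_le x (s := Finset.univ)
  have h2 := hf.sum_inner_products_le y (s := Finset.univ)
  simp only [Real.norm_eq_abs, hx, hy] at h1 h2
  have h3 : ∑ k, |inner ℝ (e k) x| * |inner ℝ (f k) y|
      ≤ ∑ k, (|inner ℝ (e k) x| ^ 2 + |inner ℝ (f k) y| ^ 2) / 2 :=
    Finset.sum_le_sum fun k _ => by
      nlinarith [sq_nonneg (|inner ℝ (e k) x| - |inner ℝ (f k) y|)]
  rw [← Finset.sum_div, Finset.sum_add_distrib] at h3
  linarith

/-- The easy half of the duality between the trace norm and the operator norm. -/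
theorem sum_abs_inner_diagMap_le {ι κ : Type*} [Fintype ι] [Fintype κ] {s : ι → ℝ}
    (hs : ∀ i, 0 ≤ s i) {p : ι → F} {q : ι → E} (hp : Orthonormal ℝ p) (hq : Orthonormal ℝ q)
    {e : κ → F} {f : κ → E} (he : Orthonormal ℝ e) (hf : Orthonormal ℝ f) :
    ∑ k, |inner ℝ (e k) (diagMap s p q (f k))| ≤ ∑ i, s i := by
  calc ∑ k, |inner ℝ (e k) (diagMap s p q (f k))|
      ≤ ∑ k, ∑ i, s i * (|inner ℝ (e k) (p i)| * |inner ℝ (f k) (q i)|) := by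
        refine Finset.sum_le_sum fun k _ => ?_
        rw [diagMap_apply, inner_sum]
        refine (Finset.abs_sum_le_sum_abs _ _).trans (Finset.sum_le_sum fun i _ => le_of_eq ?_)
        rw [real_inner_smul_right, real_inner_smul_right, abs_mul, abs_mul, abs_of_nonneg (hs i),
          real_inner_comm (q i) (f k)]
        ring
    _ = ∑ i, s i * ∑ k, |inner ℝ (e k) (p i)| * |inner ℝ (f k) (q i)| := by
        rw [Finset.sum_comm]
        simp_rw [Finset.mul_sum]
    _ ≤ ∑ i, s i := Finset.sum_le_sum fun i _ =>
        mul_le_of_le_one_right (hs i) (sum_abs_inner_mul_inner_le_one he hf (hp.1 i) (hq.1 i))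

/-! ### Reduced singular value decomposition -/

variable [FiniteDimensional ℝ E] [FiniteDimensional ℝ F] in
theorem inner_map_eigenvectorBasis (T : E →ₗ[ℝ] F) (i j : Fin (finrank ℝ E)) :
    inner ℝ (T (T.isSymmetric_adjoint_comp_self.eigenvectorBasis rfl i))
      (T (T.isSymmetric_adjoint_comp_self.eigenvectorBasis rfl j)) =
      if i = j then T.singularValues j ^ 2 else 0 := by
  rw [← LinearMap.adjoint_inner_right, ← LinearMap.comp_apply,
    LinearMap.IsSymmetric.apply_eigenvectorBasis, inner_smul_right,
    orthonormal_iff_ite.mp (OrthonormalBasis.orthonormal _), T.sq_singularValues_fin rfl]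
  split_ifs <;> simp

variable [FiniteDimensional ℝ E] [FiniteDimensional ℝ F] in
/-- The reduced singular value decomposition. -/
theorem exists_eq_diagMap_singularValues (T : E →ₗ[ℝ] F) :
    ∃ (p : Fin (finrank ℝ T.range) → F) (q : Fin (finrank ℝ T.range) → E),
      Orthonormal ℝ p ∧ Orthonormal ℝ q ∧
      T = diagMap (fun i : Fin (finrank ℝ T.range) => T.singularValues i) p q := by
  set b := T.isSymmetric_adjoint_comp_self.eigenvectorBasis rfl with hb
  have hr : finrank ℝ T.range ≤ finrank ℝ E := T.finrank_range_le
  have hpos : ∀ i : Fin (finrank ℝ T.range), 0 < T.singularValues i := fun i =>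
    T.singularValues_pos_iff_lt_finrank_range.mpr i.2
  have hq : Orthonormal ℝ (fun i : Fin (finrank ℝ T.range) => b (Fin.castLE hr i)) :=
    b.orthonormal.comp _ (Fin.castLE_injective hr)
  -- The left singular vectors are the normalized images of the eigenvectors of `T* T`.
  refine ⟨fun i => (T.singularValues i)⁻¹ • T (b (Fin.castLE hr i)),
    fun i => b (Fin.castLE hr i), ?_, hq, ?_⟩
  · rw [orthonormal_iff_ite]
    intro i j
    rw [real_inner_smul_left, real_inner_smul_right, inner_map_eigenvectorBasis]
    have hi := (hpos j).ne'
    by_cases h : i = j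
    · subst h
      simp only [if_true, Fin.val_castLE]
      field_simp
    · simp [h]
  · refine b.toBasis.ext fun j => ?_
    rw [OrthonormalBasis.coe_toBasis]
    by_cases hj : (j : ℕ) < finrank ℝ T.range
    · have := diagMap_apply_self (fun i : Fin (finrank ℝ T.range) => T.singularValues i)
        (fun i => (T.singularValues i)⁻¹ • T (b (Fin.castLE hr i))) hq ⟨j, hj⟩
      refine Eq.trans ?_ this.symm
      rw [smul_smul, mul_inv_cancel₀ (hpos ⟨j, hj⟩).ne', one_smul]
      rfl
    · have h0 : T.singularValues j = 0 :=
        T.singularValues_eq_zero_iff_le_finrank_range.mpr (not_lt.mp hj)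
      have hT : T (b j) = 0 := by
        have := inner_map_eigenvectorBasis T j j
        rw [if_pos rfl, h0, zero_pow two_ne_zero] at this
        exact inner_self_eq_zero.mp this
      rw [hT, diagMap_apply]
      refine (Finset.sum_eq_zero fun i _ => ?_).symm
      have hij : Fin.castLE hr i ≠ j := by
        rintro rfl
        exact hj i.2
      rw [b.orthonormal.2 hij, zero_smul, smul_zero]

/-! ### Triangular systems and products of three maps -/

/-- Gram–Schmidt, in the form of a triangular system. -/
theorem exists_orthonormal_triangular {r : ℕ} {w : Fin r → E} (hw : LinearIndependent ℝ w) :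
    ∃ f : Fin r → E, Orthonormal ℝ f ∧
      (∀ i, w i - inner ℝ (f i) (w i) • f i ∈ Submodule.span ℝ (w '' Set.Iio i)) ∧
      ∀ i, ∀ k < i, inner ℝ (f i) (w k) = 0 := by
  have ho := gramSchmidtNormed_orthonormal hw
  have hspan : ∀ i, Submodule.span ℝ (gramSchmidtNormed ℝ w '' Set.Iio i)
      = Submodule.span ℝ (w '' Set.Iio i) := fun i =>
    (span_gramSchmidtNormed w _).trans (span_gramSchmidt_Iio ℝ w i)
  have horth : ∀ i, ∀ x ∈ Submodule.span ℝ (w '' Set.Iio i),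
      inner ℝ (gramSchmidtNormed ℝ w i) x = 0 := by
    intro i x hx
    rw [← hspan] at hx
    induction hx using Submodule.span_induction with
    | mem x hx =>
      obtain ⟨k, hk, rfl⟩ := hx
      exact ho.2 (ne_of_gt hk)
    | zero => simp
    | add x y _ _ hx hy => rw [inner_add_right, hx, hy, add_zero]
    | smul a x _ hx => rw [inner_smul_right, hx, mul_zero]
  refine ⟨gramSchmidtNormed ℝ w, ho, fun i => ?_, fun i k hk =>
    horth i _ (Submodule.subset_span ⟨k, hk, rfl⟩)⟩
  have hmem : w i ∈ Submodule.span ℝ (gramSchmidtNormed ℝ w '' Set.Iic i) := by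
    rw [span_gramSchmidtNormed, span_gramSchmidt_Iic]
    exact Submodule.subset_span ⟨i, Set.self_mem_Iic, rfl⟩
  rw [← Set.Iio_insert, Set.image_insert_eq, Submodule.mem_span_insert, hspan] at hmem
  obtain ⟨a, z, hz, hwz⟩ := hmem
  have ha : inner ℝ (gramSchmidtNormed ℝ w i) (w i) = a := by
    rw [hwz, inner_add_right, inner_smul_right, horth i z hz, real_inner_self_eq_norm_sq, ho.1 i]
    norm_num
  rw [ha, hwz, add_sub_cancel_left]
  exact hz

/-- A functional of `T w` that vanishes on the earlier members of a family only sees the diagonal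
coefficient of `w` with respect to the triangular system. -/
theorem inner_map_eq_mul_of_triangular (T : E →ₗ[ℝ] F) {r : ℕ} {w : Fin r → E} {i : Fin r} {f : E}
    {g : F} (hf : w i - inner ℝ f (w i) • f ∈ Submodule.span ℝ (w '' Set.Iio i))
    (hg : ∀ k < i, inner ℝ g (T (w k)) = 0) :
    inner ℝ g (T (w i)) = inner ℝ f (w i) * inner ℝ g (T f) := by
  have h0 : ∀ x ∈ Submodule.span ℝ (w '' Set.Iio i), inner ℝ g (T x) = 0 := by
    intro x hx
    induction hx using Submodule.span_induction with
    | mem x hx =>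
      obtain ⟨k, hk, rfl⟩ := hx
      exact hg k hk
    | zero => simp
    | add x y _ _ hx hy => rw [map_add, inner_add_right, hx, hy, add_zero]
    | smul a x _ hx => rw [map_smul, inner_smul_right, hx, mul_zero]
  have := h0 _ hf
  rw [map_sub, map_smul, inner_sub_right, inner_smul_right] at this
  linarith

/-- The positive singular values of a product of three maps are products of diagonal coefficients
of the factors with respect to suitable orthonormal families. -/
theorem exists_orthonormal_eq_mul_mul {E' : Type*} [NormedAddCommGroup E'] [InnerProductSpace ℝ E']
    (A : F →ₗ[ℝ] G) (B : E →ₗ[ℝ] F) (C : E' →ₗ[ℝ] E) {r : ℕ} {σ : Fin r → ℝ}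
    (hσ : ∀ i, σ i ≠ 0) {p : Fin r → G} {q : Fin r → E'} (hp : Orthonormal ℝ p)
    (h : ∀ i, A (B (C (q i))) = σ i • p i) :
    ∃ (f : Fin r → E) (g : Fin r → F), Orthonormal ℝ f ∧ Orthonormal ℝ g ∧
      ∀ i, σ i = inner ℝ (p i) (A (g i)) * inner ℝ (g i) (B (f i)) * inner ℝ (f i) (C (q i)) := by
  -- Independence of the final images `σ i • p i` pulls back to both intermediate families, so
  -- Gram–Schmidt applies to each.
  have hABC : LinearIndependent ℝ (A ∘ fun i => B (C (q i))) := by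
    rw [show (A ∘ fun i => B (C (q i))) = (fun i => Units.mk0 (σ i) (hσ i)) • p from funext h]
    exact hp.linearIndependent.units_smul _
  have hBC : LinearIndependent ℝ (B ∘ fun i => C (q i)) := hABC.of_comp A
  have hC : LinearIndependent ℝ (fun i => C (q i)) := hBC.of_comp B
  obtain ⟨f, hfo, hf, -⟩ := exists_orthonormal_triangular hC
  obtain ⟨g, hgo, hg, hg0⟩ := exists_orthonormal_triangular hBC
  refine ⟨f, g, hfo, hgo, fun i => ?_⟩
  have h1 := inner_map_eq_mul_of_triangular B (hf i) (hg0 i)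
  -- On the last level `p` itself serves as the triangular family: the images `σ k • p k` are
  -- already orthogonal.
  have h2 := inner_map_eq_mul_of_triangular A (hg i) (g := p i) fun k hk => by
    simp only [Function.comp_apply]
    rw [h k, inner_smul_right, hp.2 (ne_of_gt hk), mul_zero]
  simp only [Function.comp_apply] at h2
  rw [h i, inner_smul_right, real_inner_self_eq_norm_sq, hp.1 i, h1] at h2
  linarith

end LinearMaps

/-! ### Hölder's inequality -/

theorem rpow_third_pow_three {x : ℝ} (hx : 0 ≤ x) : (x ^ (1 / 3 : ℝ)) ^ 3 = x := by
  rw [← Real.rpow_natCast, ← Real.rpow_mul hx]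
  norm_num

/-- Hölder's inequality for three factors. -/
theorem sum_rpow_third_pow_three_le {ι : Type*} [Fintype ι] {a b c : ι → ℝ}
    (ha : ∀ i, 0 ≤ a i) (hb : ∀ i, 0 ≤ b i) (hc : ∀ i, 0 ≤ c i) :
    (∑ i, (a i * b i * c i) ^ (1 / 3 : ℝ)) ^ 3 ≤ (∑ i, a i) * (∑ i, b i) * ∑ i, c i := by
  have zero_case : ∀ {u : ι → ℝ}, (∀ i, 0 ≤ u i) → ∑ i, u i = 0 → ∀ i, u i = 0 := fun hu h i =>
    (Finset.sum_eq_zero_iff_of_nonneg fun i _ => hu i).mp h i (Finset.mem_univ i)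
  rcases (Finset.sum_nonneg fun i _ => ha i : 0 ≤ ∑ i, a i).eq_or_lt' with hA | hA
  · have := zero_case ha hA
    simp [this]
  rcases (Finset.sum_nonneg fun i _ => hb i : 0 ≤ ∑ i, b i).eq_or_lt' with hB | hB
  · have := zero_case hb hB
    simp [this]
  rcases (Finset.sum_nonneg fun i _ => hc i : 0 ≤ ∑ i, c i).eq_or_lt' with hC | hC
  · have := zero_case hc hC
    simp [this]
  set A := ∑ i, a i with hAdef
  set B := ∑ i, b i with hBdef
  set C := ∑ i, c i with hCdef
  have hABC : 0 < A * B * C := by positivity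
  -- AM-GM for the sequences scaled to total mass one; the bracket on the right then sums to 1.
  have key : ∀ i, (a i * b i * c i) ^ (1 / 3 : ℝ) ≤
      (A * B * C) ^ (1 / 3 : ℝ) * (1 / 3 * (a i / A) + 1 / 3 * (b i / B) + 1 / 3 * (c i / C)) := by
    intro i
    have h1 : 0 ≤ a i / A := div_nonneg (ha i) hA.le
    have h2 : 0 ≤ b i / B := div_nonneg (hb i) hB.le
    have h3 : 0 ≤ c i / C := div_nonneg (hc i) hC.le
    have := Real.geom_mean_le_arith_mean3_weighted (w₁ := 1 / 3) (w₂ := 1 / 3) (w₃ := 1 / 3)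
      (by norm_num) (by norm_num) (by norm_num) h1 h2 h3 (by norm_num)
    rw [← Real.mul_rpow h1 h2, ← Real.mul_rpow (mul_nonneg h1 h2) h3] at this
    calc (a i * b i * c i) ^ (1 / 3 : ℝ)
        = (A * B * C * (a i / A * (b i / B) * (c i / C))) ^ (1 / 3 : ℝ) := by
          congr 1
          field_simp
      _ = (A * B * C) ^ (1 / 3 : ℝ) * (a i / A * (b i / B) * (c i / C)) ^ (1 / 3 : ℝ) :=
          Real.mul_rpow hABC.le (mul_nonneg (mul_nonneg h1 h2) h3)
      _ ≤ _ := by gcongr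
  have hsum : ∑ i, (a i * b i * c i) ^ (1 / 3 : ℝ) ≤ (A * B * C) ^ (1 / 3 : ℝ) := by
    refine (Finset.sum_le_sum fun i _ => key i).trans (le_of_eq ?_)
    rw [← Finset.mul_sum, Finset.sum_add_distrib, Finset.sum_add_distrib, ← Finset.mul_sum,
      ← Finset.mul_sum, ← Finset.mul_sum, ← Finset.sum_div, ← Finset.sum_div, ← Finset.sum_div,
      ← hAdef, ← hBdef, ← hCdef, div_self hA.ne', div_self hB.ne', div_self hC.ne']
    ring
  calc _ ≤ ((A * B * C) ^ (1 / 3 : ℝ)) ^ 3 := by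
        have : 0 ≤ ∑ i, (a i * b i * c i) ^ (1 / 3 : ℝ) := Finset.sum_nonneg fun i _ =>
          Real.rpow_nonneg (mul_nonneg (mul_nonneg (ha i) (hb i)) (hc i)) _
        gcongr
    _ = A * B * C := by
        exact rpow_third_pow_three hABC.le

/-! ### Singular values and trace norm of matrices -/

theorem finrank_range_toEuclideanLin {m n : ℕ} (X : Matrix (Fin m) (Fin n) ℝ) :
    finrank ℝ (Matrix.toEuclideanLin X).range = X.rank := by
  rw [Matrix.toEuclideanLin_eq_toLin_orthonormal]
  exact (Matrix.rank_eq_finrank_range_toLin X _ _).symm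

theorem matSingularValue_nonneg {m n : ℕ} (X : Matrix (Fin m) (Fin n) ℝ) (i : ℕ) :
    0 ≤ matSingularValue X i :=
  LinearMap.singularValues_nonneg _ _

theorem matSingularValue_pos_iff {m n : ℕ} (X : Matrix (Fin m) (Fin n) ℝ) (i : ℕ) :
    0 < matSingularValue X i ↔ i < X.rank := by
  rw [← finrank_range_toEuclideanLin]
  exact LinearMap.singularValues_pos_iff_lt_finrank_range _

theorem matSingularValue_of_rank_le {m n : ℕ} (X : Matrix (Fin m) (Fin n) ℝ) {i : ℕ}
    (hi : X.rank ≤ i) : matSingularValue X i = 0 :=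
  le_antisymm (not_lt.mp fun h => hi.not_gt ((matSingularValue_pos_iff X i).mp h))
    (matSingularValue_nonneg X i)

theorem rank_le_min {m n : ℕ} (X : Matrix (Fin m) (Fin n) ℝ) : X.rank ≤ min m n :=
  le_min X.rank_le_height X.rank_le_width

/-- Reindexes by `Fin X.rank`, the index type of the reduced decomposition, for the trace norm and
the Schatten sum at once. -/
theorem sum_range_min_matSingularValue {m n : ℕ} (X : Matrix (Fin m) (Fin n) ℝ) {φ : ℝ → ℝ}
    (hφ : φ 0 = 0) :
    ∑ i ∈ Finset.range (min m n), φ (matSingularValue X i) =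
      ∑ i : Fin X.rank, φ (matSingularValue X i) := by
  rw [Fin.sum_univ_eq_sum_range fun i => φ (matSingularValue X i)]
  refine (Finset.sum_subset (Finset.range_mono (rank_le_min X)) fun i _ hi => ?_).symm
  rw [matSingularValue_of_rank_le X (by simpa using hi), hφ]

theorem traceNorm_eq_sum {m n : ℕ} (X : Matrix (Fin m) (Fin n) ℝ) :
    traceNorm X = ∑ i : Fin X.rank, matSingularValue X i :=
  sum_range_min_matSingularValue X (φ := id) rfl

theorem traceNorm_nonneg {m n : ℕ} (X : Matrix (Fin m) (Fin n) ℝ) : 0 ≤ traceNorm X :=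
  Finset.sum_nonneg fun _ _ => matSingularValue_nonneg X _

theorem schattenNorm_third_eq {m n : ℕ} (X : Matrix (Fin m) (Fin n) ℝ) :
    schattenNorm (1 / 3) X = (∑ i : Fin X.rank, matSingularValue X i ^ (1 / 3 : ℝ)) ^ 3 := by
  rw [schattenNorm, sum_range_min_matSingularValue X (φ := fun x => x ^ (1 / 3 : ℝ))
    (Real.zero_rpow (by norm_num)), ← Real.rpow_natCast]
  norm_num

/-- The reduced singular value decomposition of a matrix. -/
theorem exists_toEuclideanLin_eq_diagMap {m n : ℕ} (X : Matrix (Fin m) (Fin n) ℝ) :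
    ∃ (p : Fin X.rank → EuclideanSpace ℝ (Fin m)) (q : Fin X.rank → EuclideanSpace ℝ (Fin n)),
      Orthonormal ℝ p ∧ Orthonormal ℝ q ∧
      Matrix.toEuclideanLin X = diagMap (fun i : Fin X.rank => matSingularValue X i) p q := by
  have h := exists_eq_diagMap_singularValues (Matrix.toEuclideanLin X)
  rwa [finrank_range_toEuclideanLin] at h

theorem sum_abs_inner_le_traceNorm {m n : ℕ} (X : Matrix (Fin m) (Fin n) ℝ) {κ : Type*} [Fintype κ]
    {e : κ → EuclideanSpace ℝ (Fin m)} {f : κ → EuclideanSpace ℝ (Fin n)}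
    (he : Orthonormal ℝ e) (hf : Orthonormal ℝ f) :
    ∑ k, |inner ℝ (e k) (Matrix.toEuclideanLin X (f k))| ≤ traceNorm X := by
  obtain ⟨p, q, hp, hq, hX⟩ := exists_toEuclideanLin_eq_diagMap X
  rw [hX, traceNorm_eq_sum]
  exact sum_abs_inner_diagMap_le (fun i => matSingularValue_nonneg X _) hp hq he hf

/-- The singular vectors attain the duality bound, so the trace norm is a maximum of linear
functionals; subadditivity and homogeneity follow from this. -/
theorem exists_traceNorm_eq_sum_inner {m n : ℕ} (X : Matrix (Fin m) (Fin n) ℝ) :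
    ∃ (p : Fin X.rank → EuclideanSpace ℝ (Fin m)) (q : Fin X.rank → EuclideanSpace ℝ (Fin n)),
      Orthonormal ℝ p ∧ Orthonormal ℝ q ∧
      traceNorm X = ∑ i, inner ℝ (p i) (Matrix.toEuclideanLin X (q i)) := by
  obtain ⟨p, q, hp, hq, hX⟩ := exists_toEuclideanLin_eq_diagMap X
  refine ⟨p, q, hp, hq, ?_⟩
  rw [traceNorm_eq_sum]
  refine Finset.sum_congr rfl fun i _ => ?_
  rw [hX, diagMap_apply_self _ _ hq, inner_smul_right, real_inner_self_eq_norm_sq, hp.1 i]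
  ring

theorem traceNorm_add_le {m n : ℕ} (X Y : Matrix (Fin m) (Fin n) ℝ) :
    traceNorm (X + Y) ≤ traceNorm X + traceNorm Y := by
  obtain ⟨p, q, hp, hq, h⟩ := exists_traceNorm_eq_sum_inner (X + Y)
  refine le_trans ?_ (add_le_add (sum_abs_inner_le_traceNorm X hp hq)
    (sum_abs_inner_le_traceNorm Y hp hq))
  rw [h, ← Finset.sum_add_distrib]
  refine Finset.sum_le_sum fun i _ => ?_
  rw [map_add, LinearMap.add_apply, inner_add_right]
  exact add_le_add (le_abs_self _) (le_abs_self _)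

theorem traceNorm_smul_le {m n : ℕ} (a : ℝ) (X : Matrix (Fin m) (Fin n) ℝ) :
    traceNorm (a • X) ≤ |a| * traceNorm X := by
  obtain ⟨p, q, hp, hq, h⟩ := exists_traceNorm_eq_sum_inner (a • X)
  refine le_trans ?_ (mul_le_mul_of_nonneg_left (sum_abs_inner_le_traceNorm X hp hq) (abs_nonneg a))
  rw [h, Finset.mul_sum]
  refine Finset.sum_le_sum fun i _ => ?_
  rw [map_smul, LinearMap.smul_apply, inner_smul_right, ← abs_mul]
  exact le_abs_self _

/-- By duality there is no need to identify the `s i` with the ordered singular values. -/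
theorem traceNorm_le_of_eq_diagMap {m n : ℕ} {X : Matrix (Fin m) (Fin n) ℝ} {ι : Type*} [Fintype ι]
    {s : ι → ℝ} (hs : ∀ i, 0 ≤ s i) {p : ι → EuclideanSpace ℝ (Fin m)}
    {q : ι → EuclideanSpace ℝ (Fin n)} (hp : Orthonormal ℝ p) (hq : Orthonormal ℝ q)
    (hX : Matrix.toEuclideanLin X = diagMap s p q) : traceNorm X ≤ ∑ i, s i := by
  obtain ⟨e, f, he, hf, h⟩ := exists_traceNorm_eq_sum_inner X
  rw [h, hX]
  exact (Finset.sum_le_sum fun i _ => le_abs_self _).trans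
    (sum_abs_inner_diagMap_le hs hp hq he hf)

theorem eq_zero_of_traceNorm_eq_zero {m n : ℕ} {X : Matrix (Fin m) (Fin n) ℝ}
    (h : traceNorm X = 0) : X = 0 := by
  rw [traceNorm_eq_sum, Finset.sum_eq_zero_iff_of_nonneg fun i _ => matSingularValue_nonneg X _] at h
  obtain ⟨p, q, -, -, hX⟩ := exists_toEuclideanLin_eq_diagMap X
  rw [← (Matrix.toEuclideanLin (𝕜 := ℝ) (m := Fin m) (n := Fin n)).map_eq_zero_iff, hX]
  ext1 x
  rw [diagMap_apply, LinearMap.zero_apply]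
  exact Finset.sum_eq_zero fun i hi => by rw [h i hi, zero_smul]

/-! ### The tri-trace norm as the Schatten-1/3 quasi-norm -/

theorem toEuclideanLin_mul_mul_transpose {m n d : ℕ} (U : Matrix (Fin m) (Fin d) ℝ)
    (V : Matrix (Fin d) (Fin d) ℝ) (W : Matrix (Fin n) (Fin d) ℝ) :
    Matrix.toEuclideanLin (U * V * W.transpose) = Matrix.toEuclideanLin U ∘ₗ
      Matrix.toEuclideanLin V ∘ₗ LinearMap.adjoint (Matrix.toEuclideanLin W) := by
  rw [← Matrix.toEuclideanLin_conjTranspose_eq_adjoint, Matrix.conjTranspose_eq_transpose_of_trivial,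
    Matrix.toLpLin_mul_same, Matrix.toLpLin_mul_same, LinearMap.comp_assoc]

/-- The Schatten-`1/3` quasi-norm is a lower bound of the tri-trace values. -/
theorem schattenNorm_third_mul_mul_le {m n d : ℕ} (U : Matrix (Fin m) (Fin d) ℝ)
    (V : Matrix (Fin d) (Fin d) ℝ) (W : Matrix (Fin n) (Fin d) ℝ) :
    schattenNorm (1 / 3) (U * V * W.transpose) ≤ traceNorm U * traceNorm V * traceNorm W := by
  set X := U * V * W.transpose with hXdef
  obtain ⟨p, q, hp, hq, hX⟩ := exists_toEuclideanLin_eq_diagMap X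
  have hpq : ∀ i, Matrix.toEuclideanLin U (Matrix.toEuclideanLin V
      (LinearMap.adjoint (Matrix.toEuclideanLin W) (q i))) = matSingularValue X i • p i := by
    intro i
    have := diagMap_apply_self (fun i : Fin X.rank => matSingularValue X i) p hq i
    rw [← hX] at this
    rw [← this, hXdef, toEuclideanLin_mul_mul_transpose]
    rfl
  obtain ⟨f, g, hf, hg, hσ⟩ := exists_orthonormal_eq_mul_mul _ _ _
    (fun i : Fin X.rank => ((matSingularValue_pos_iff X i).mpr i.2).ne') hp hpq
  rw [schattenNorm_third_eq]
  -- The individual coefficients may be negative; only their product is known to be nonnegative.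
  have habs : ∀ i : Fin X.rank, matSingularValue X i =
      |inner ℝ (p i) (Matrix.toEuclideanLin U (g i))| *
      |inner ℝ (g i) (Matrix.toEuclideanLin V (f i))| *
      |inner ℝ (q i) (Matrix.toEuclideanLin W (f i))| := by
    intro i
    rw [← abs_of_nonneg (matSingularValue_nonneg X i), hσ i, abs_mul, abs_mul,
      LinearMap.adjoint_inner_right, real_inner_comm (q i)]
  simp_rw [habs]
  refine (sum_rpow_third_pow_three_le (fun i => abs_nonneg _) (fun i => abs_nonneg _)
    fun i => abs_nonneg _).trans ?_
  have hU := sum_abs_inner_le_traceNorm U hp hg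
  have hV := sum_abs_inner_le_traceNorm V hg hf
  have hW := sum_abs_inner_le_traceNorm W hq hf
  have := traceNorm_nonneg U
  have := traceNorm_nonneg V
  gcongr

/-- Each factor carries the cube roots of the singular values, and the three are glued along one
orthonormal family in `ℝ^d`, which has room for it because the rank is at most `d`. -/
theorem exists_factorization_le_schattenNorm_third {m n d : ℕ} (X : Matrix (Fin m) (Fin n) ℝ)
    (hd : X.rank ≤ d) :
    ∃ (U : Matrix (Fin m) (Fin d) ℝ) (V : Matrix (Fin d) (Fin d) ℝ) (W : Matrix (Fin n) (Fin d) ℝ),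
      X = U * V * W.transpose ∧
      traceNorm U * traceNorm V * traceNorm W ≤ schattenNorm (1 / 3) X := by
  obtain ⟨p, q, hp, hq, hX⟩ := exists_toEuclideanLin_eq_diagMap X
  set s : Fin X.rank → ℝ := fun i => matSingularValue X i ^ (1 / 3 : ℝ) with hs
  have hs0 : ∀ i, 0 ≤ s i := fun i => Real.rpow_nonneg (matSingularValue_nonneg X i) _
  have hs3 : ∀ i, s i * (s i * s i) = matSingularValue X i := by
    intro i
    rw [← pow_two, ← pow_succ']
    exact rpow_third_pow_three (matSingularValue_nonneg X i)
  set e : Fin X.rank → EuclideanSpace ℝ (Fin d) :=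
    fun i => EuclideanSpace.basisFun (Fin d) ℝ (Fin.castLE hd i)
  have he : Orthonormal ℝ e :=
    (EuclideanSpace.basisFun (Fin d) ℝ).orthonormal.comp _ (Fin.castLE_injective hd)
  have hU := Matrix.toEuclideanLin.apply_symm_apply (diagMap s p e)
  have hV := Matrix.toEuclideanLin.apply_symm_apply (diagMap s e e)
  have hW := Matrix.toEuclideanLin.apply_symm_apply (diagMap s q e)
  refine ⟨Matrix.toEuclideanLin.symm (diagMap s p e), Matrix.toEuclideanLin.symm (diagMap s e e),
    Matrix.toEuclideanLin.symm (diagMap s q e), ?_, ?_⟩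
  · apply Matrix.toEuclideanLin.injective
    rw [toEuclideanLin_mul_mul_transpose, hU, hV, hW, adjoint_diagMap, diagMap_comp _ _ _ _ he,
      diagMap_comp _ _ _ _ he, hX]
    simp_rw [hs3]
  · rw [schattenNorm_third_eq, pow_three']
    have h1 := traceNorm_le_of_eq_diagMap hs0 hp he hU
    have h2 := traceNorm_le_of_eq_diagMap hs0 he he hV
    have h3 := traceNorm_le_of_eq_diagMap hs0 hq he hW
    have h0 : 0 ≤ ∑ i, s i := Finset.sum_nonneg fun i _ => hs0 i
    exact mul_le_mul (mul_le_mul h1 h2 (traceNorm_nonneg _) h0) h3 (traceNorm_nonneg _)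
      (mul_nonneg h0 h0)

theorem isLeast_triTraceValues {m n d : ℕ} (X : Matrix (Fin m) (Fin n) ℝ) (hd : X.rank ≤ d) :
    IsLeast (triTraceValues d X) (schattenNorm (1 / 3) X) := by
  constructor
  · obtain ⟨U, V, W, hX, hle⟩ := exists_factorization_le_schattenNorm_third X hd
    refine ⟨U, V, W, hX, le_antisymm ?_ hle⟩
    conv_lhs => rw [hX]
    exact schattenNorm_third_mul_mul_le U V W
  · rintro t ⟨U, V, W, hX, rfl⟩
    rw [hX]
    exact schattenNorm_third_mul_mul_le U V W

theorem triTraceNorm_eq_schattenNorm_third {m n d : ℕ} (X : Matrix (Fin m) (Fin n) ℝ)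
    (hd : X.rank ≤ d) : triTraceNorm d X = schattenNorm (1 / 3) X :=
  (isLeast_triTraceValues X hd).csInf_eq

/-! ### Comparison with the trace norm and the quasi-norm axioms -/

theorem sum_pow_three_le_pow_three_sum {ι : Type*} [Fintype ι] {s : ι → ℝ} (hs : ∀ i, 0 ≤ s i) :
    ∑ i, s i ^ 3 ≤ (∑ i, s i) ^ 3 := by
  have h0 : 0 ≤ ∑ i, s i := Finset.sum_nonneg fun i _ => hs i
  calc ∑ i, s i ^ 3 ≤ ∑ i, s i * (∑ i, s i) ^ 2 := by
        refine Finset.sum_le_sum fun i _ => ?_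
        rw [pow_succ']
        have := Finset.single_le_sum (fun i _ => hs i) (Finset.mem_univ i)
        exact mul_le_mul_of_nonneg_left (pow_le_pow_left₀ (hs i) this 2) (hs i)
    _ = (∑ i, s i) ^ 3 := by rw [← Finset.sum_mul, ← pow_succ']

theorem traceNorm_le_schattenNorm_third {m n : ℕ} (X : Matrix (Fin m) (Fin n) ℝ) :
    traceNorm X ≤ schattenNorm (1 / 3) X := by
  rw [schattenNorm_third_eq, traceNorm_eq_sum]
  refine le_trans (le_of_eq ?_) (sum_pow_three_le_pow_three_sum fun i =>
    Real.rpow_nonneg (matSingularValue_nonneg X _) _)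
  exact Finset.sum_congr rfl fun i _ => (rpow_third_pow_three (matSingularValue_nonneg X _)).symm

/-- At most `m` singular values are nonzero and each is at most the trace norm; the constant is
crude. -/
theorem schattenNorm_third_le_mul_traceNorm {m n : ℕ} (X : Matrix (Fin m) (Fin n) ℝ) :
    schattenNorm (1 / 3) X ≤ (m : ℝ) ^ 3 * traceNorm X := by
  have hT := traceNorm_nonneg X
  have hr : (X.rank : ℝ) ≤ m := by exact_mod_cast X.rank_le_height
  have h : ∑ i : Fin X.rank, matSingularValue X i ^ (1 / 3 : ℝ)
      ≤ X.rank * traceNorm X ^ (1 / 3 : ℝ) := by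
    refine (Finset.sum_le_card_nsmul _ _ (traceNorm X ^ (1 / 3 : ℝ)) fun i _ => ?_).trans ?_
    · refine Real.rpow_le_rpow (matSingularValue_nonneg X _) ?_ (by norm_num)
      rw [traceNorm_eq_sum]
      exact Finset.single_le_sum (f := fun i : Fin X.rank => matSingularValue X i)
        (fun i _ => matSingularValue_nonneg X _) (Finset.mem_univ i)
    · simp
  rw [schattenNorm_third_eq]
  calc _ ≤ (X.rank * traceNorm X ^ (1 / 3 : ℝ)) ^ 3 :=
        pow_le_pow_left₀ (Finset.sum_nonneg fun i _ =>
          Real.rpow_nonneg (matSingularValue_nonneg X _) _) h 3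
    _ = (X.rank : ℝ) ^ 3 * traceNorm X := by rw [mul_pow, rpow_third_pow_three hT]
    _ ≤ _ := by gcongr

theorem rank_smul_le {m n : ℕ} (a : ℝ) (X : Matrix (Fin m) (Fin n) ℝ) :
    (a • X).rank ≤ X.rank := by
  rw [show a • X = X * (a • (1 : Matrix (Fin n) (Fin n) ℝ)) by
    rw [Matrix.mul_smul, Matrix.mul_one]]
  exact Matrix.rank_mul_le_left _ _

/-- The scalar is absorbed into `U` in an optimal factorization. -/
theorem triTraceNorm_smul_le {m n d : ℕ} (a : ℝ) (X : Matrix (Fin m) (Fin n) ℝ)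
    (hd : X.rank ≤ d) : triTraceNorm d (a • X) ≤ |a| * triTraceNorm d X := by
  rw [triTraceNorm_eq_schattenNorm_third X hd,
    triTraceNorm_eq_schattenNorm_third _ ((rank_smul_le a X).trans hd)]
  obtain ⟨U, V, W, hX, hle⟩ := exists_factorization_le_schattenNorm_third X hd
  calc schattenNorm (1 / 3) (a • X) = schattenNorm (1 / 3) ((a • U) * V * W.transpose) := by
        rw [Matrix.smul_mul, Matrix.smul_mul, ← hX]
    _ ≤ traceNorm (a • U) * traceNorm V * traceNorm W := schattenNorm_third_mul_mul_le _ _ _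
    _ ≤ |a| * traceNorm U * traceNorm V * traceNorm W := by
        have := traceNorm_nonneg V
        have := traceNorm_nonneg W
        gcongr
        exact traceNorm_smul_le a U
    _ = |a| * (traceNorm U * traceNorm V * traceNorm W) := by ring
    _ ≤ |a| * schattenNorm (1 / 3) X := by gcongr

/-- No rank condition is needed: if no factorization exists, the real infimum of the empty set is 0.
-/
theorem triTraceNorm_nonneg {m n : ℕ} (d : ℕ) (X : Matrix (Fin m) (Fin n) ℝ) :
    0 ≤ triTraceNorm d X := by
  refine Real.sInf_nonneg ?_
  rintro t ⟨U, V, W, -, rfl⟩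
  exact mul_nonneg (mul_nonneg (traceNorm_nonneg _) (traceNorm_nonneg _)) (traceNorm_nonneg _)

theorem isQuasiNormOn_triTraceNorm (m n d : ℕ) :
    IsQuasiNormOn {X : Matrix (Fin m) (Fin n) ℝ | X.rank ≤ d} (triTraceNorm d) where
  nonneg X _ := triTraceNorm_nonneg d X
  eq_zero_iff X hX := by
    constructor
    · intro h
      rw [triTraceNorm_eq_schattenNorm_third X hX] at h
      exact eq_zero_of_traceNorm_eq_zero
        (le_antisymm (h ▸ traceNorm_le_schattenNorm_third X) (traceNorm_nonneg X))
    · rintro rfl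
      have := triTraceNorm_smul_le 0 (0 : Matrix (Fin m) (Fin n) ℝ) hX
      rw [smul_zero, abs_zero, zero_mul] at this
      exact le_antisymm this (triTraceNorm_nonneg d _)
  smul a X hX := by
    refine le_antisymm (triTraceNorm_smul_le a X hX) ?_
    rcases eq_or_ne a 0 with rfl | ha
    · rw [abs_zero, zero_mul]
      exact triTraceNorm_nonneg d _
    -- The reverse inequality is the same bound for `a⁻¹` applied to `a • X`.
    · have := triTraceNorm_smul_le a⁻¹ (a • X) ((rank_smul_le a X).trans hX)
      rw [smul_smul, inv_mul_cancel₀ ha, one_smul, abs_inv] at this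
      rwa [← le_inv_mul_iff₀ (abs_pos.mpr ha)]
  add_le := by
    -- The summand 1 secures `1 ≤ α` even for `m = 0`.
    refine ⟨(m : ℝ) ^ 3 + 1, le_add_of_nonneg_left (by positivity), fun X hX Y hY hXY => ?_⟩
    rw [triTraceNorm_eq_schattenNorm_third X hX, triTraceNorm_eq_schattenNorm_third Y hY,
      triTraceNorm_eq_schattenNorm_third _ hXY]
    have h1 := traceNorm_le_schattenNorm_third X
    have h2 := traceNorm_le_schattenNorm_third Y
    have h3 := traceNorm_nonneg X
    have h4 := traceNorm_nonneg Y
    calc schattenNorm (1 / 3) (X + Y) ≤ (m : ℝ) ^ 3 * traceNorm (X + Y) :=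
          schattenNorm_third_le_mul_traceNorm _
      _ ≤ (m : ℝ) ^ 3 * (schattenNorm (1 / 3) X + schattenNorm (1 / 3) Y) := by
          gcongr
          exact (traceNorm_add_le X Y).trans (add_le_add h1 h2)
      _ ≤ ((m : ℝ) ^ 3 + 1) * (schattenNorm (1 / 3) X + schattenNorm (1 / 3) Y) := by
          gcongr
          · linarith
          · linarith

theorem theorem2 (m n d : ℕ) :
    (∀ X : Matrix (Fin m) (Fin n) ℝ, X.rank ≤ d →
      IsLeast (triTraceValues d X) (triTraceNorm d X)) ∧
    IsQuasiNormOn {X : Matrix (Fin m) (Fin n) ℝ | X.rank ≤ d} (triTraceNorm d) ∧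
    (min m n ≤ d → IsQuasiNorm (fun X : Matrix (Fin m) (Fin n) ℝ => triTraceNorm d X)) ∧
    (∀ X : Matrix (Fin m) (Fin n) ℝ, X.rank ≤ d →
      triTraceNorm d X = schattenNorm (1 / 3) X) := by
  refine ⟨fun X hX => ?_, isQuasiNormOn_triTraceNorm m n d, fun h => ?_,
    fun X hX => triTraceNorm_eq_schattenNorm_third X hX⟩
  · rw [triTraceNorm_eq_schattenNorm_third X hX]
    exact isLeast_triTraceValues X hX
  · have huniv : {X : Matrix (Fin m) (Fin n) ℝ | X.rank ≤ d} = Set.univ :=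
      Set.eq_univ_of_forall fun X => (rank_le_min X).trans h
    have := isQuasiNormOn_triTraceNorm m n d
    rwa [huniv] at this
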